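/- Let $(P,\preceq)$ be a finite poset with $n$ elements that is a rooted tree, i.e. $P$ has a unique minimal element and its Hasse diagram is a tree. Let $P$ be naturally labeled: its ground set is identified with $\{1,\dots,n\}$ in such a way that $a\prec b$ implies $a<b$. Let $\hat P=P\cup\{0\}$ be $P$ with a new minimum $0$ adjoined. For a permutation $\tau\in\mathfrak S_n$ set $\tau(0)=0$ and $\hat\tau=\tau^{-1}$. Let $\mathrm{ides}(\tau)$ be the number of $0\le i<n$ with $\hat\tau(i)>\hat\tau(i+1)$; such $i$ are the inverse descents of $\tau$. Call $\tau\in\mathfrak S_n$ descent-compatible if for each $a\in P$ the number of descents of the word $\tau(c_1)\tau(c_2)\cdots\tau(c_k)$ is the same for all saturated chains $0=c_1\prec\!\!\cdot\, c_2\prec\!\!\cdot\cdots\prec\!\!\cdot\, c_k=a$ in $\hat P$; write $\mathrm{des}_{P,\tau}(a)$ for this number, with $\mathrm{des}_{P,\tau}(0)=0$, and $\mathrm{DC}(P)\subseteq\mathfrak S_n$ for the set of descent-compatible permutations. For $\tau\in\mathrm{DC}(P)$ let $\mathrm{stat}_P(\tau)$ be the number of $i\in\{0,\dots,n-1\}$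 such that $$\mathrm{des}_{P,\tau}(\hat\tau(i))<\mathrm{des}_{P,\tau}(\hat\tau(i+1)),\quad\text{or}\quad \mathrm{des}_{P,\tau}(\hat\tau(i))=\mathrm{des}_{P,\tau}(\hat\tau(i+1))\text{ and } i \text{ is an inverse descent of }\tau .$$ Let $A^{(2)}_n(z)=\sum_{\tau\in\mathfrak S_n}z^{\mathrm{bigiasc}(\tau)}$, where $\mathrm{bigiasc}(\tau)$ is the number of $0\le i<n$ with $\hat\tau(i+1)-\hat\tau(i)\ge 2$. Then $$\sum_{\tau\in\mathrm{DC}(P)}z^{\mathrm{stat}_P(\tau)}\;=\;A^{(2)}_n(z)\;=\;\sum_{\tau\in\mathfrak S_n}z^{\mathrm{ides}(\tau)},$$ the last sum being the Eulerian polynomial. -/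

import Mathlib

open Polynomial

namespace PosetStat

noncomputable section

/-! ### Permutations of `{1, …, n}`, extended by `τ(0) = 0`

A permutation of `{1, …, n}` is an `Equiv.Perm (Fin n)`, where `i : Fin n` stands for `i + 1`. -/

/-- The permutation of `{0, 1, …, n}` that extends `τ` by `τ(0) = 0`. -/
def hat {n : ℕ} (τ : Equiv.Perm (Fin n)) : Equiv.Perm (Fin (n + 1)) where
  toFun := Fin.cases 0 fun i => (τ i).succ
  invFun := Fin.cases 0 fun i => (τ⁻¹ i).succ
  left_inv i := by refine Fin.cases ?_ (fun j => ?_) i <;> simp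
  right_inv i := by refine Fin.cases ?_ (fun j => ?_) i <;> simp

/-- The descent set `{0 ≤ i < n : τ(i) > τ(i+1)}`. -/
def Des {n : ℕ} (τ : Equiv.Perm (Fin n)) : Finset (Fin n) :=
  {i | hat τ i.succ < hat τ i.castSucc}

/-- The inverse descent set: the descent set of the inverse permutation. -/
def iDes {n : ℕ} (τ : Equiv.Perm (Fin n)) : Finset (Fin n) := Des τ⁻¹

/-- The number of inverse descents. -/
def ides {n : ℕ} (τ : Equiv.Perm (Fin n)) : ℕ := (iDes τ).card

/-- The number of big ascents: indices `0 ≤ i < n` with `τ(i+1) - τ(i) ≥ 2`. -/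
def bigasc {n : ℕ} (τ : Equiv.Perm (Fin n)) : ℕ :=
  Finset.card {i : Fin n | (hat τ i.castSucc : ℕ) + 2 ≤ (hat τ i.succ : ℕ)}

/-- The number of inverse big ascents. -/
def bigiasc {n : ℕ} (τ : Equiv.Perm (Fin n)) : ℕ := bigasc τ⁻¹

/-- The `2`-Eulerian polynomial `A^{(2)}_n`, the generating function of (inverse) big ascents. -/
def A2 (n : ℕ) : ℤ[X] := ∑ τ : Equiv.Perm (Fin n), X ^ bigiasc τ

/-- Big ascents and inverse big ascents give the same polynomial. -/
theorem A2_eq_sum_bigasc (n : ℕ) : A2 n = ∑ τ : Equiv.Perm (Fin n), X ^ bigasc τ :=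
  Equiv.sum_comp (Equiv.inv (Equiv.Perm (Fin n))) fun τ => (X : ℤ[X]) ^ bigasc τ

/-! ### Posets, labelings, and descents along saturated chains

`P` is a finite poset, `ω : P ≃ Fin n` a labeling of its elements by `{1, …, n}`, and `WithBot P`
is the poset with a new minimum adjoined, which gets the label `0`. -/

/-- A rooted tree: a poset with a unique minimal element whose Hasse diagram is a tree. -/
def IsRootedTree (P : Type*) [PartialOrder P] : Prop :=
  (∃! a : P, IsMin a) ∧ (SimpleGraph.hasse P).IsTree

/-- A labeling is natural if `a < b` in `P` implies that the label of `a` is less than that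
of `b`. -/
def IsNatural {P : Type*} [PartialOrder P] {n : ℕ} (ω : P ≃ Fin n) : Prop :=
  ∀ a b : P, a < b → ω a < ω b

/-- The label in `{0, …, n}` of an element of `P` with a minimum adjoined. -/
def label {P : Type*} {n : ℕ} (ω : P ≃ Fin n) : WithBot P → Fin (n + 1) :=
  WithBot.recBotCoe 0 fun a => (ω a).succ

/-- The element of `P` with a minimum adjoined that carries a given label. -/
def unlabel {P : Type*} {n : ℕ} (ω : P ≃ Fin n) : Fin (n + 1) → WithBot P :=
  Fin.cases ⊥ fun i => (ω.symm i : P)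

theorem unlabel_label {P : Type*} {n : ℕ} (ω : P ≃ Fin n) (a : WithBot P) :
    unlabel ω (label ω a) = a := by
  induction a with
  | bot => rfl
  | coe a => simp [label, unlabel]

theorem label_unlabel {P : Type*} {n : ℕ} (ω : P ≃ Fin n) (i : Fin (n + 1)) :
    label ω (unlabel ω i) = i := by
  refine Fin.cases rfl (fun j => ?_) i
  simp [label, unlabel]

/-- The number of descents of a word, i.e. of adjacent letters `x y` with `x > y`. -/
def wordDes {m : ℕ} : List (Fin m) → ℕ
  | [] => 0
  | [_] => 0
  | x :: y :: w => (if y < x then 1 else 0) + wordDes (y :: w)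

/-- `C` is a saturated chain `⊥ = c₁ ⋖ c₂ ⋖ ⋯ ⋖ c_k = a` in `P` with a minimum adjoined. -/
def IsSatChain {P : Type*} [PartialOrder P] (C : List (WithBot P)) (a : WithBot P) : Prop :=
  C.IsChain (· ⋖ ·) ∧ C.head? = some ⊥ ∧ C.getLast? = some a

/-- The number of descents of the word `τ(c₁) τ(c₂) ⋯ τ(c_k)`. -/
def chainDes {P : Type*} {n : ℕ} (ω : P ≃ Fin n) (τ : Equiv.Perm (Fin n))
    (C : List (WithBot P)) : ℕ :=
  wordDes (C.map fun c => hat τ (label ω c))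

/-- `τ` is descent-compatible: the number of descents along a saturated chain from the adjoined
minimum to an element `a` depends only on `a`. -/
def IsDescentCompatible {P : Type*} [PartialOrder P] {n : ℕ} (ω : P ≃ Fin n)
    (τ : Equiv.Perm (Fin n)) : Prop :=
  ∀ (a : P) (C C' : List (WithBot P)), IsSatChain C a → IsSatChain C' a →
    chainDes ω τ C = chainDes ω τ C'

/-- The number of descents along any saturated chain from the adjoined minimum to `a`. For
descent-compatible `τ` the set below has exactly one element. -/
def desP {P : Type*} [PartialOrder P] {n : ℕ} (ω : P ≃ Fin n) (τ : Equiv.Perm (Fin n))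
    (a : WithBot P) : ℕ :=
  sInf {d | ∃ C, IsSatChain C a ∧ chainDes ω τ C = d}

theorem desP_eq {P : Type*} [PartialOrder P] {n : ℕ} {ω : P ≃ Fin n} {τ : Equiv.Perm (Fin n)}
    (h : IsDescentCompatible ω τ) {a : P} {C : List (WithBot P)} (hC : IsSatChain C a) :
    desP ω τ a = chainDes ω τ C := by
  have : {d | ∃ C, IsSatChain C (a : WithBot P) ∧ chainDes ω τ C = d} = {chainDes ω τ C} := by
    ext d
    constructor
    · rintro ⟨C', hC', rfl⟩
      exact h a C' C hC' hC
    · rintro rfl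
      exact ⟨C, hC, rfl⟩
  rw [desP, this, csInf_singleton]

theorem desP_bot {P : Type*} [PartialOrder P] {n : ℕ} (ω : P ≃ Fin n) (τ : Equiv.Perm (Fin n)) :
    desP ω τ ⊥ = 0 := by
  refine Nat.le_zero.1 (Nat.sInf_le ⟨[⊥], ⟨by simp, rfl, rfl⟩, rfl⟩)

open Classical in
/-- The statistic `stat_P(τ)`: the number of `0 ≤ i < n` such that, for the elements `a`, `b` with
labels `τ⁻¹(i)` and `τ⁻¹(i+1)`, either `des(a) < des(b)`, or `des(a) = des(b)` and `i` is an
inverse descent of `τ`. -/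
def stat {P : Type*} [PartialOrder P] {n : ℕ} (ω : P ≃ Fin n) (τ : Equiv.Perm (Fin n)) : ℕ :=
  Finset.card {i : Fin n |
    desP ω τ (unlabel ω (hat τ⁻¹ i.castSucc)) < desP ω τ (unlabel ω (hat τ⁻¹ i.succ)) ∨
    (desP ω τ (unlabel ω (hat τ⁻¹ i.castSucc)) = desP ω τ (unlabel ω (hat τ⁻¹ i.succ)) ∧
      i ∈ iDes τ)}

open Classical in
/-- The generating function of `stat` over all descent-compatible permutations. -/
def GenFun {P : Type*} [PartialOrder P] {n : ℕ} (ω : P ≃ Fin n) : ℤ[X] :=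
  ∑ τ : Equiv.Perm (Fin n) with IsDescentCompatible ω τ, X ^ stat ω τ

end

end PosetStat

/-! ### Level ascents of words and insertion of the largest letter -/

namespace PosetStat

/-! In a rooted tree with `0` adjoined each `a ≠ 0` covers one element, its parent, of smaller
label. So every `τ` is descent-compatible, and `stat` counts the ascents of `0 τ⁻¹(1) ⋯ τ⁻¹(n)` in
the order by level, then decreasing label.

The largest label `t` is a leaf, so inserting it changes no other level. In this order it is the
least letter of its level. Were that level fixed, a gap would keep the ascent number iff it is an
ascent not straddling `t`, a descent straddling `t`, or the end after a letter above `t`. Up and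
down crossings of `t` alternate, so the number of such gaps is the ascent number, plus one if the
first letter lies above `t` (`sum_levelAsc_insert`). In fact the level of `t` is one higher before
its parent `p` than after it: `p` ends the first stretch below `t` and starts the second above it,
which adds one (`sum_levelAsc_insert_leaf`). As the word starts with `0`, at level 0, exactly `s +
1` of the `n + 1` gaps keep the statistic `s` and the others raise it by one, whatever the tree.

Hence all trees share one distribution (`sum_treeStat_eq`). The star gives `ides`, the path
`bigiasc`. -/

/-- The number of descents of `pos` along the path from `0` to `a` in the tree with parent
function `par`, where `par a < a` for all nodes `a ≠ 0`. -/
def level (par pos : ℕ → ℕ) (a : ℕ) : ℕ :=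
  if h : par a < a then level par pos (par a) + (if pos a < pos (par a) then 1 else 0) else 0
termination_by a

theorem level_of_lt {par pos : ℕ → ℕ} {a : ℕ} (h : par a < a) :
    level par pos a = level par pos (par a) + (if pos a < pos (par a) then 1 else 0) := by
  rw [level, dif_pos h]

theorem level_zero (par pos : ℕ → ℕ) : level par pos 0 = 0 := by
  rw [level, dif_neg (by simp)]

/-- The level depends only on the relative order of the positions. -/
theorem level_congr {par pos pos' : ℕ → ℕ} {n : ℕ}
    (h : ∀ a ≤ n, ∀ b ≤ n, (pos a < pos b ↔ pos' a < pos' b)) {a : ℕ} (ha : a ≤ n) :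
    level par pos a = level par pos' a := by
  induction a using Nat.strong_induction_on with
  | _ a ih =>
    by_cases hp : par a < a
    · rw [level_of_lt hp, level_of_lt hp, ih _ hp (by omega)]
      simp only [h a ha (par a) (by omega)]
    · rw [level, dif_neg hp, level, dif_neg hp]

/-- `b` exceeds `a` in the order by level and then by decreasing label. -/
def LevelLT (d : ℕ → ℕ) (a b : ℕ) : Prop := d a < d b ∨ (d a = d b ∧ b < a)

instance (d : ℕ → ℕ) (a b : ℕ) : Decidable (LevelLT d a b) := by
  unfold LevelLT; infer_instance

/-- The number of ascents of a word with respect to `LevelLT d`. -/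
def levelAsc (d : ℕ → ℕ) : List ℕ → ℕ
  | [] => 0
  | [_] => 0
  | x :: y :: w => (if LevelLT d x y then 1 else 0) + levelAsc d (y :: w)

theorem levelAsc_congr {d d' : ℕ → ℕ} : ∀ {w : List ℕ}, (∀ a ∈ w, d a = d' a) →
    levelAsc d w = levelAsc d' w
  | [], _ => rfl
  | [_], _ => rfl
  | x :: y :: w, h => by
    have : LevelLT d x y ↔ LevelLT d' x y := by
      unfold LevelLT; rw [h x (by simp), h y (by simp)]
    simp only [levelAsc, this]
    rw [levelAsc_congr fun a ha => h a (List.mem_cons_of_mem _ ha)]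

variable {R : Type*} [CommRing R]

/-- Inserting a largest letter of fixed level into a word, anywhere but in front. -/
theorem sum_levelAsc_insert (d : ℕ → ℕ) (t : ℕ) (l : List ℕ) :
    ∀ (g : ℕ → R) (a : ℕ), a < t → (∀ x ∈ l, x < t) →
    ((l.permutations'Aux t).map fun w => g (levelAsc d (a :: w))).sum =
      (levelAsc d (a :: l) + (if d t ≤ d a then 1 else 0)) * g (levelAsc d (a :: l)) +
      (l.length + 1 - levelAsc d (a :: l) - (if d t ≤ d a then 1 else 0)) *
        g (levelAsc d (a :: l) + 1) := by
  induction l with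
  | nil =>
    intro g a ha _
    by_cases h : d t ≤ d a
    · have : ¬ LevelLT d a t := by unfold LevelLT; omega
      simp [List.permutations'Aux, levelAsc, h, this]
    · have : LevelLT d a t := by unfold LevelLT; omega
      simp [List.permutations'Aux, levelAsc, h, this]
  | cons y ys ih =>
    intro g a ha hl
    have hy : y < t := hl y (by simp)
    -- Insertions after `y` leave the pair `a y` intact, so its contribution is absorbed into the
    -- weight.
    have h2 := ih (fun s => g ((if LevelLT d a y then 1 else 0) + s)) y hy
      fun x hx => hl x (by simp [hx])
    simp only [List.permutations'Aux, List.map_cons, List.map_map, Function.comp_def, levelAsc,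
      List.sum_cons] at h2 ⊢
    rw [h2]
    have e1 : LevelLT d a t ↔ ¬ d t ≤ d a := by unfold LevelLT; omega
    have e2 : LevelLT d t y ↔ d t ≤ d y := by unfold LevelLT; omega
    by_cases h1 : d t ≤ d a <;> by_cases h3 : d t ≤ d y <;> by_cases h4 : LevelLT d a y
    all_goals first
      | (exfalso; unfold LevelLT at h4; omega)
      | (simp only [e1, e2, h1, h3, h4, not_true, not_false_iff, if_true, if_false,
          List.length_cons, zero_add]
         push_cast
         ring_nf)

/-- Inserting a largest letter `t` into a word, anywhere but in front, where the level of `t` is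
that of `p`, plus one if `t` is inserted before `p`. -/
theorem sum_levelAsc_insert_leaf {d d' : ℕ → ℕ} {t p : ℕ} (hdt : d t = d p)
    (hdt' : d' t = d p + 1) (hd : ∀ a, a < t → d' a = d a) (l : List ℕ) :
    ∀ (g : ℕ → R) (a : ℕ), a < t → (∀ x ∈ l, x < t) → p ∈ a :: l →
    ((l.permutations'Aux t).map fun w => g (levelAsc
        (if (a :: w).idxOf t < (a :: w).idxOf p then d' else d) (a :: w))).sum =
      (levelAsc d (a :: l) + (if d p < d a then 1 else 0) + 1) * g (levelAsc d (a :: l)) +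
      (l.length - levelAsc d (a :: l) - (if d p < d a then 1 else 0)) *
        g (levelAsc d (a :: l) + 1) := by
  induction l with
  | nil =>
    intro g a ha hl hp
    obtain rfl : p = a := by simpa using hp
    have := sum_levelAsc_insert d t [] g p ha hl
    simp only [List.idxOf_cons_self, Nat.not_lt_zero, if_false]
    rw [this]
    simp [hdt]
  | cons y ys ih =>
    intro g a ha hl hp
    have hy : y < t := hl y (by simp)
    by_cases hpa : p = a
    -- All insertions now fall after `p`, so the level of `t` is fixed.
    · subst hpa
      have := sum_levelAsc_insert d t (y :: ys) g p ha hl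
      simp only [List.idxOf_cons_self, Nat.not_lt_zero, if_false]
      rw [this]
      simp only [hdt, le_refl, lt_irrefl, if_true, if_false]
      ring
    · have hp' : p ∈ y :: ys := by simpa [hpa] using hp
      have hpt : p < t := hl p hp'
      have h2 := ih (fun s => g ((if LevelLT d a y then 1 else 0) + s)) y hy
        (fun x hx => hl x (by simp [hx])) hp'
      have hc : ∀ w : List ℕ, ((a :: y :: w).idxOf t < (a :: y :: w).idxOf p ↔
          (y :: w).idxOf t < (y :: w).idxOf p) := fun w => by
        rw [List.idxOf_cons_ne _ (by omega), List.idxOf_cons_ne _ (Ne.symm hpa)]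
        omega
      -- The gap between `a` and `y` lies before `p`, so `t` has the raised level there.
      have hc0 : ((a :: t :: y :: ys).idxOf t < (a :: t :: y :: ys).idxOf p) := by
        rw [List.idxOf_cons_ne _ (by omega), List.idxOf_cons_ne _ (Ne.symm hpa),
          List.idxOf_cons_self, List.idxOf_cons_ne _ (by omega)]
        omega
      have hA : ∀ (P : Prop) [Decidable P] (w : List ℕ),
          levelAsc (if P then d' else d) (a :: y :: w) =
          (if LevelLT d a y then 1 else 0) + levelAsc (if P then d' else d) (y :: w) := by
        intro P _ w
        have : LevelLT d' a y ↔ LevelLT d a y := by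
          unfold LevelLT; rw [hd a ha, hd y hy]
        split_ifs <;> simp_all [levelAsc]
      have hB : levelAsc d' (a :: t :: y :: ys) =
          (if LevelLT d' a t then 1 else 0) + ((if LevelLT d' t y then 1 else 0) +
            levelAsc d (y :: ys)) := by
        rw [levelAsc, levelAsc, levelAsc_congr (d := d') (d' := d) (w := y :: ys)]
        intro x hx
        exact hd x (hl x hx)
      simp only [List.permutations'Aux, List.map_cons, List.map_map, Function.comp_def,
        List.sum_cons, hc0, if_true, hc, hA, hB] at h2 ⊢
      rw [h2]
      have e1 : LevelLT d' a t ↔ ¬ d p < d a := by unfold LevelLT; rw [hd a ha]; omega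
      have e2 : LevelLT d' t y ↔ d p < d y := by unfold LevelLT; rw [hd y hy]; omega
      simp only [levelAsc]
      by_cases h1 : d p < d a <;> by_cases h3 : d p < d y <;> by_cases h4 : LevelLT d a y
      all_goals first
        | (exfalso; unfold LevelLT at h4; omega)
        | (simp only [e1, e2, h1, h3, h4, not_true, not_false_iff, if_true, if_false,
            List.length_cons, zero_add]
           push_cast
           ring_nf)

theorem mem_permutations'Aux {α : Type*} {t : α} {l w : List α} :
    w ∈ l.permutations'Aux t ↔ ∃ u v, l = u ++ v ∧ w = u ++ t :: v := by
  induction l generalizing w with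
  | nil => simp [List.permutations'Aux]
  | cons y ys ih =>
    simp only [List.permutations'Aux, List.mem_cons, List.mem_map, ih]
    constructor
    · rintro (rfl | ⟨_, ⟨u, v, rfl, rfl⟩, rfl⟩)
      · exact ⟨[], _, rfl, rfl⟩
      · exact ⟨y :: u, v, rfl, rfl⟩
    · rintro ⟨_ | ⟨z, u⟩, v, h1, rfl⟩
      · exact Or.inl (by rw [List.nil_append] at h1; simp [h1])
      · simp only [List.cons_append, List.cons.injEq] at h1
        exact Or.inr ⟨_, ⟨u, v, h1.2, rfl⟩, by simp [h1.1]⟩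

theorem idxOf_lt_idxOf_insert {α : Type*} [DecidableEq α] {t x y : α} (hx : x ≠ t) (hy : y ≠ t)
    (u v : List α) : (u ++ t :: v).idxOf x < (u ++ t :: v).idxOf y ↔
      (u ++ v).idxOf x < (u ++ v).idxOf y := by
  induction u with
  | nil =>
    simp only [List.nil_append]
    rw [List.idxOf_cons_ne _ hx.symm, List.idxOf_cons_ne _ hy.symm]
    omega
  | cons z u ih =>
    simp only [List.cons_append]
    simp only [List.idxOf_cons]
    by_cases h1 : z == x <;> by_cases h2 : z == y <;> simp [h1, h2, ih]

/-! ### Independence of the tree -/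

/-- The number of level ascents of the word `0 w` for the tree with parent function `par`. -/
def treeStat (par : ℕ → ℕ) (w : List ℕ) : ℕ :=
  levelAsc (level par fun a => (0 :: w).idxOf a) (0 :: w)

/-- The letters `n, …, 1`. -/
def letters : ℕ → List ℕ
  | 0 => []
  | n + 1 => (n + 1) :: letters n

theorem mem_letters {n a : ℕ} : a ∈ letters n ↔ 1 ≤ a ∧ a ≤ n := by
  induction n with
  | zero => simp [letters]; omega
  | succ n ih => simp only [letters, List.mem_cons, ih]; omega

theorem length_letters (n : ℕ) : (letters n).length = n := by
  induction n with
  | zero => rfl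
  | succ n ih => simp [letters, ih]

theorem nodup_letters (n : ℕ) : (letters n).Nodup := by
  induction n with
  | zero => simp [letters]
  | succ n ih => simp [letters, ih, mem_letters]

/-- Inserting a new largest label, necessarily of a leaf. -/
theorem sum_treeStat_insert {par : ℕ → ℕ} {n : ℕ} (hpar : par (n + 1) ≤ n) {l : List ℕ}
    (hl : l.Perm (letters n)) (g : ℕ → R) :
    ((l.permutations'Aux (n + 1)).map fun w => g (treeStat par w)).sum =
      (treeStat par l + 1) * g (treeStat par l) + (n - treeStat par l) * g (treeStat par l + 1) := by
  have hmem : ∀ a, a ∈ l ↔ 1 ≤ a ∧ a ≤ n := fun a => by rw [hl.mem_iff, mem_letters]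
  set d := level par fun a => (0 :: l).idxOf a with hd
  set p := par (n + 1) with hp
  -- Only the level of the new leaf depends on the gap: `d p` after its parent, `d p + 1` before it.
  have key := sum_levelAsc_insert_leaf (d := Function.update d (n + 1) (d p))
    (d' := Function.update d (n + 1) (d p + 1)) (t := n + 1) (p := p)
    (by simp; rw [Function.update_of_ne (by omega)])
    (by simp; rw [Function.update_of_ne (by omega)])
    (fun a ha => by rw [Function.update_of_ne ha.ne, Function.update_of_ne ha.ne]) l g 0 (by omega)
    (fun x hx => by have := (hmem x).1 hx; omega)
    (by simp only [List.mem_cons, hmem]; omega)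
  have h0 : levelAsc (Function.update d (n + 1) (d p)) (0 :: l) = treeStat par l := by
    refine levelAsc_congr fun a ha => Function.update_of_ne ?_ _ _
    simp only [List.mem_cons, hmem] at ha
    omega
  -- The last trace of the tree in the count vanishes because the root has level 0.
  have h1 : ¬ (Function.update d (n + 1) (d p) p < Function.update d (n + 1) (d p) 0) := by
    rw [Function.update_of_ne (by omega) _ _, Function.update_of_ne (by omega) _ _, hd, level_zero]
    omega
  rw [h0, if_neg h1, hl.length_eq, length_letters] at key
  simp only [add_zero, sub_zero] at key
  rw [← key]
  refine congrArg List.sum (List.map_congr_left fun w hw => congrArg g ?_)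
  obtain ⟨u, v, rfl, rfl⟩ := mem_permutations'Aux.1 hw
  have hlow : ∀ a ≤ n, level par (fun a => (0 :: (u ++ (n + 1) :: v)).idxOf a) a = d a :=
    fun a ha => level_congr (n := n) (fun x hx y hy => by
      simpa using idxOf_lt_idxOf_insert (t := n + 1) (x := x) (y := y) (by omega) (by omega)
        (0 :: u) v) ha
  refine levelAsc_congr fun a ha => ?_
  rcases eq_or_ne a (n + 1) with rfl | hne
  · rw [level_of_lt (by omega), ← hp, hlow _ hpar]
    split_ifs <;> simp
  · have : a ≤ n := by
      have := hmem a
      simp only [List.mem_cons, List.mem_append] at ha this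
      by_cases h : a = 0
      · omega
      · exact (this.1 (by tauto)).2
    rw [hlow _ this]
    split_ifs <;> rw [Function.update_of_ne hne]

/-- The distribution of `treeStat` does not depend on the tree. -/
theorem sum_treeStat_eq {par par' : ℕ → ℕ} (n : ℕ) (h : ∀ i < n, par (i + 1) ≤ i)
    (h' : ∀ i < n, par' (i + 1) ≤ i) (g : ℕ → R) :
    ((letters n).permutations'.map fun w => g (treeStat par w)).sum =
      ((letters n).permutations'.map fun w => g (treeStat par' w)).sum := by
  induction n generalizing g with
  | zero => simp [letters, treeStat, levelAsc]
  | succ n ih =>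
    -- The insertion recursion is pushed into the weight; an arbitrary `g` makes the induction
    -- close.
    have step : ∀ q : ℕ → ℕ, (∀ i < n + 1, q (i + 1) ≤ i) →
        ((letters (n + 1)).permutations'.map fun w => g (treeStat q w)).sum =
        ((letters n).permutations'.map fun w => (fun s : ℕ => ((s : R) + 1) * g s +
          (n - s) * g (s + 1)) (treeStat q w)).sum := by
      intro q hq
      simp only [letters, List.permutations', List.flatMap_def,
        List.map_flatten, List.sum_flatten, List.map_map]
      refine congrArg List.sum (List.map_congr_left fun l hl => ?_)
      exact sum_treeStat_insert (hq n (by omega)) (List.mem_permutations'.1 hl) g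
    rw [step par h, step par' h']
    exact ih (fun i hi => h i (by omega)) (fun i hi => h' i (by omega))
      fun s : ℕ => ((s : R) + 1) * g s + (n - s) * g (s + 1)

end PosetStat

/-! ### From words to permutations; the star and the path -/

namespace PosetStat

/-- The word `τ⁻¹(1) ⋯ τ⁻¹(n)`. -/
def invWord {n : ℕ} (τ : Equiv.Perm (Fin n)) : List ℕ :=
  List.ofFn fun i => (τ⁻¹ i : ℕ) + 1

/-- The position of a letter in the word `0 τ⁻¹(1) ⋯ τ⁻¹(n)`. -/
def pos {n : ℕ} (τ : Equiv.Perm (Fin n)) (a : ℕ) : ℕ :=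
  if h : a < n + 1 then hat τ ⟨a, h⟩ else 0

theorem pos_val {n : ℕ} (τ : Equiv.Perm (Fin n)) (a : Fin (n + 1)) : pos τ a = hat τ a := by
  simp [pos, a.2]

theorem hat_hat_inv {n : ℕ} (τ : Equiv.Perm (Fin n)) (i : Fin (n + 1)) :
    hat τ (hat τ⁻¹ i) = i := by
  refine Fin.cases ?_ (fun j => ?_) i <;> simp [hat]

theorem hat_inv_hat {n : ℕ} (τ : Equiv.Perm (Fin n)) (i : Fin (n + 1)) :
    hat τ⁻¹ (hat τ i) = i := by
  simpa using hat_hat_inv τ⁻¹ i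

theorem pos_hat_inv {n : ℕ} (τ : Equiv.Perm (Fin n)) (i : Fin (n + 1)) :
    pos τ (hat τ⁻¹ i) = i := by
  rw [pos_val, hat_hat_inv]

theorem zero_cons_invWord {n : ℕ} (τ : Equiv.Perm (Fin n)) :
    0 :: invWord τ = List.ofFn fun i => (hat τ⁻¹ i : ℕ) := by
  rw [List.ofFn_succ]
  rfl

theorem levelAsc_ofFn (d : ℕ → ℕ) : ∀ {n : ℕ} (f : Fin (n + 1) → ℕ),
    levelAsc d (List.ofFn f) =
      Finset.card {i : Fin n | LevelLT d (f i.castSucc) (f i.succ)}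
  | 0, f => by simp [List.ofFn_succ, levelAsc]
  | n + 1, f => by
    have ih := levelAsc_ofFn d fun i => f i.succ
    rw [Finset.card_filter] at ih ⊢
    rw [Fin.sum_univ_succ, List.ofFn_succ]
    simp only [Fin.castSucc_zero, ← Fin.succ_castSucc]
    rw [← ih, List.ofFn_succ, levelAsc]
    rfl

/-- The statistic `treeStat` in terms of permutations. -/
def permStat (par : ℕ → ℕ) {n : ℕ} (τ : Equiv.Perm (Fin n)) : ℕ :=
  Finset.card {i : Fin n |
    LevelLT (level par (pos τ)) (hat τ⁻¹ i.castSucc : ℕ) (hat τ⁻¹ i.succ : ℕ)}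

theorem idxOf_zero_cons_invWord {n : ℕ} (τ : Equiv.Perm (Fin n)) {a : ℕ} (ha : a ≤ n) :
    (0 :: invWord τ).idxOf a = pos τ a := by
  have hinj : Function.Injective fun i => (hat τ⁻¹ i : ℕ) :=
    Fin.val_injective.comp (hat τ⁻¹).injective
  have hn := List.nodup_ofFn.2 hinj
  have hi : (hat τ ⟨a, by omega⟩ : ℕ) < (List.ofFn fun i => (hat τ⁻¹ i : ℕ)).length := by
    rw [List.length_ofFn]; exact Fin.is_lt _
  have h1 := hn.idxOf_getElem _ hi
  simp only [List.getElem_ofFn, Fin.eta, hat_inv_hat] at h1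
  rw [zero_cons_invWord, h1, ← pos_val]

theorem treeStat_invWord (par : ℕ → ℕ) {n : ℕ} (τ : Equiv.Perm (Fin n)) :
    treeStat par (invWord τ) = permStat par τ := by
  have : treeStat par (invWord τ) = levelAsc (level par (pos τ)) (0 :: invWord τ) := by
    refine levelAsc_congr fun a ha => level_congr (n := n) (fun x hx y hy => ?_) ?_
    · rw [idxOf_zero_cons_invWord τ hx, idxOf_zero_cons_invWord τ hy]
    · rw [zero_cons_invWord, List.mem_ofFn] at ha
      obtain ⟨i, rfl⟩ := ha
      exact Fin.is_le _
  rw [this, zero_cons_invWord, levelAsc_ofFn]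
  rfl

theorem invWord_injective {n : ℕ} : Function.Injective (invWord (n := n)) := by
  intro τ τ' h
  have h1 := List.ofFn_injective h
  refine inv_injective (Equiv.ext fun i => Fin.ext ?_)
  have := congrFun h1 i
  simpa using this

theorem invWord_perm {n : ℕ} (τ : Equiv.Perm (Fin n)) : (invWord τ).Perm (letters n) := by
  refine (List.perm_ext_iff_of_nodup (List.nodup_ofFn.2 ?_) (nodup_letters n)).2 fun a => ?_
  · intro i j h
    exact τ⁻¹.injective (Fin.ext (by simpa using h))
  · rw [List.mem_ofFn, mem_letters]
    constructor
    · rintro ⟨i, rfl⟩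
      have := (τ⁻¹ i).2
      omega
    · rintro ⟨h1, h2⟩
      exact ⟨τ ⟨a - 1, by omega⟩, by simp; omega⟩

theorem nodup_permutations'_letters (n : ℕ) : (letters n).permutations'.Nodup :=
  (List.permutations_perm_permutations' _).nodup_iff.1 (List.nodup_permutations _ (nodup_letters n))

theorem image_invWord (n : ℕ) :
    Finset.univ.image (invWord (n := n)) = (letters n).permutations'.toFinset := by
  refine Finset.eq_of_subset_of_card_le (fun w hw => ?_) ?_
  · obtain ⟨τ, -, rfl⟩ := Finset.mem_image.1 hw
    exact List.mem_toFinset.2 (List.mem_permutations'.2 (invWord_perm τ))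
  · rw [Finset.card_image_of_injective _ invWord_injective, Finset.card_univ, Fintype.card_perm,
      Fintype.card_fin, List.toFinset_card_of_nodup (nodup_permutations'_letters n),
      ← (List.permutations_perm_permutations' _).length_eq, List.length_permutations,
      length_letters]

theorem sum_permStat {R : Type*} [CommRing R] (par : ℕ → ℕ) (n : ℕ) (g : ℕ → R) :
    ∑ τ : Equiv.Perm (Fin n), g (permStat par τ) =
      ((letters n).permutations'.map fun w => g (treeStat par w)).sum := by
  rw [← List.sum_toFinset _ (nodup_permutations'_letters n), ← image_invWord,
    Finset.sum_image invWord_injective.injOn]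
  simp only [treeStat_invWord]

/-- The distribution of `permStat` does not depend on the tree. -/
theorem sum_permStat_eq {R : Type*} [CommRing R] {par par' : ℕ → ℕ} (n : ℕ)
    (h : ∀ i < n, par (i + 1) ≤ i) (h' : ∀ i < n, par' (i + 1) ≤ i) (g : ℕ → R) :
    ∑ τ : Equiv.Perm (Fin n), g (permStat par τ) =
      ∑ τ : Equiv.Perm (Fin n), g (permStat par' τ) := by
  rw [sum_permStat, sum_permStat, sum_treeStat_eq n h h']

theorem level_const_zero {n : ℕ} (τ : Equiv.Perm (Fin n)) (a : ℕ) :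
    level (fun _ => 0) (pos τ) a = 0 := by
  rcases Nat.eq_zero_or_pos a with rfl | h
  · exact level_zero _ _
  · rw [level_of_lt h, level_zero]
    simp [pos, hat]

/-- In the star every node is a child of `0`, which has the first position, so all levels are 0. -/
theorem permStat_const_zero {n : ℕ} (τ : Equiv.Perm (Fin n)) :
    permStat (fun _ => 0) τ = ides τ := by
  simp [permStat, ides, iDes, Des, LevelLT, level_const_zero]

theorem level_pred_succ (pos : ℕ → ℕ) (a : ℕ) : level (fun k => k - 1) pos (a + 1) =
    level (fun k => k - 1) pos a + (if pos (a + 1) < pos a then 1 else 0) := by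
  rw [level_of_lt (by simp)]
  rfl

theorem level_pred_mono (pos : ℕ → ℕ) : Monotone (level (fun k => k - 1) pos) :=
  monotone_nat_of_le_succ fun a => by rw [level_pred_succ]; omega

/-- On the path, equal levels mean that no descent occurs between `a` and `b`. -/
theorem pos_le_of_level_pred_eq (pos : ℕ → ℕ) {a b : ℕ} (hab : a ≤ b)
    (h : level (fun k => k - 1) pos a = level (fun k => k - 1) pos b) : pos a ≤ pos b := by
  induction b, hab using Nat.le_induction with
  | base => rfl
  | succ b hab ih =>
    have h1 := level_pred_mono pos hab
    rw [level_pred_succ] at h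
    have h2 := ih (by omega)
    by_contra h3
    rw [if_pos (by omega)] at h
    omega

theorem permStat_pred {n : ℕ} (τ : Equiv.Perm (Fin n)) :
    permStat (fun k => k - 1) τ = bigiasc τ := by
  unfold permStat bigiasc bigasc
  congr 1
  ext i
  simp only [Finset.mem_filter, Finset.mem_univ, true_and]
  have hu := pos_hat_inv τ i.castSucc
  have hv := pos_hat_inv τ i.succ
  have hvn := (hat τ⁻¹ i.succ).is_le
  have hinj : ∀ a ≤ n, ∀ b ≤ n, pos τ a = pos τ b → a = b := by
    intro a ha b hb h
    simp only [pos, show a < n + 1 by omega, show b < n + 1 by omega, dif_pos] at h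
    simpa using (hat τ).injective (Fin.ext h)
  generalize (hat τ⁻¹ i.castSucc : ℕ) = u at *
  generalize (hat τ⁻¹ i.succ : ℕ) = v at *
  simp only [Fin.val_castSucc, Fin.val_succ] at hu hv
  unfold LevelLT
  constructor
  · rintro h
    by_contra hlt
    rcases Nat.lt_or_ge u v with h1 | h1
    · obtain rfl : v = u + 1 := by omega
      rw [level_pred_succ, if_neg (by omega)] at h
      omega
    · have h2 := level_pred_mono (pos τ) h1
      have h3 := pos_le_of_level_pred_eq (pos τ) h1
      omega
  -- Otherwise `u`, `u + 1`, `v` share a level, and the position of `u + 1` is squeezed between the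
  -- consecutive positions of `u` and `v`.
  · intro h
    have h1 := level_pred_mono (pos τ) (show u ≤ u + 1 by omega)
    have h2 := level_pred_mono (pos τ) (show u + 1 ≤ v by omega)
    by_contra h3
    have h4 := pos_le_of_level_pred_eq (pos τ) (show u ≤ u + 1 by omega) (by omega)
    have h5 := pos_le_of_level_pred_eq (pos τ) (show u + 1 ≤ v by omega) (by omega)
    have h6 := hinj u (by omega) (u + 1) (by omega)
    have h7 := hinj (u + 1) (by omega) v (by omega)
    omega

end PosetStat

/-! ### Covers and saturated chains in rooted trees -/

namespace PosetStat

/-- Below any element of a finite poset there is a path in the Hasse diagram to a smaller one. -/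
theorem exists_walk_of_le {P : Type*} [PartialOrder P] [Finite P] (r : P) :
    ∀ b, r ≤ b → ∃ w : (SimpleGraph.hasse P).Walk r b, ∀ x ∈ w.support, x ≤ b := by
  intro b
  induction b using WellFoundedLT.induction with
  | _ b ih =>
    intro hrb
    rcases hrb.eq_or_lt with rfl | hlt
    · exact ⟨.nil, by simp⟩
    · obtain ⟨c, hrc, hcb⟩ := exists_le_covBy_of_lt hlt
      obtain ⟨w, hw⟩ := ih c hcb.lt hrc
      have hadj : (SimpleGraph.hasse P).Adj c b := Or.inl hcb
      refine ⟨w.concat hadj, fun x hx => ?_⟩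
      rw [SimpleGraph.Walk.support_concat] at hx
      simp only [List.mem_append, List.mem_singleton] at hx
      rcases hx with hx | rfl
      · exact (hw x hx).trans hcb.le
      · rfl

/-- Two lower covers of `a` would be penultimate vertices of two paths from the root to `a`, but
paths in a tree are unique. -/
theorem IsRootedTree.covBy_unique {P : Type*} [PartialOrder P] [Finite P] (hP : IsRootedTree P)
    {a b c : P} (hb : b ⋖ a) (hc : c ⋖ a) : b = c := by
  classical
  obtain ⟨⟨r, hr, hru⟩, htree⟩ := hP
  have hle : ∀ x, r ≤ x := fun x => by
    obtain ⟨m, hmx, hm⟩ := exists_minimal_le_of_wellFoundedLT (fun _ : P => True) x trivial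
    rw [← hru m (by simpa using hm)]
    exact hmx
  have path : ∀ x, x ⋖ a → ∃ (p : (SimpleGraph.hasse P).Path r a), p.1.penultimate = x := by
    intro x hx
    obtain ⟨w, hw⟩ := exists_walk_of_le r x (hle x)
    have hadj : (SimpleGraph.hasse P).Adj x a := Or.inl hx
    -- The walk stays weakly below `x`, so appending `a` still gives a path.
    have hnot : a ∉ w.bypass.support := fun h =>
      (hw a (w.support_bypass_subset_support h)).not_gt hx.lt
    exact ⟨⟨w.bypass.concat hadj, w.bypass_isPath.concat hnot hadj⟩,
      SimpleGraph.Walk.penultimate_concat _ _⟩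
  obtain ⟨p, rfl⟩ := path b hb
  obtain ⟨q, rfl⟩ := path c hc
  have := htree.isAcyclic.subsingleton_path r a
  rw [Subsingleton.elim p q]

/-- In a rooted tree with a new minimum adjoined, every other element covers exactly one. -/
theorem IsRootedTree.existsUnique_covBy {P : Type*} [PartialOrder P] [Finite P]
    (hP : IsRootedTree P) (a : P) : ∃! b : WithBot P, b ⋖ a := by
  obtain ⟨b, -, hb⟩ := exists_le_covBy_of_lt (WithBot.bot_lt_coe a)
  refine ⟨b, hb, fun c hc => ?_⟩
  induction b with
  | bot =>
    induction c with
    | bot => rfl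
    | coe c =>
      exact absurd (WithBot.coe_covBy_coe.1 hc).lt (WithBot.bot_covBy_coe.1 hb).not_lt
  | coe b =>
    have hb := WithBot.coe_covBy_coe.1 hb
    induction c with
    | bot => exact absurd hb.lt (WithBot.bot_covBy_coe.1 hc).not_lt
    | coe c => rw [hP.covBy_unique hb (WithBot.coe_covBy_coe.1 hc)]

theorem wordDes_append_pair {m : ℕ} (x y : Fin m) : ∀ w : List (Fin m),
    wordDes (w ++ [x, y]) = wordDes (w ++ [x]) + (if y < x then 1 else 0)
  | [] => by simp [wordDes]
  | [z] => by simp [wordDes]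
  | z :: z' :: w => by
    have := wordDes_append_pair x y (z' :: w)
    simp only [List.cons_append, wordDes] at this ⊢
    rw [this, add_assoc]

section

variable {P : Type*} [PartialOrder P]

theorem isSatChain_bot {C : List (WithBot P)} : IsSatChain C ⊥ ↔ C = [⊥] := by
  constructor
  · rintro ⟨h1, h2, h3⟩
    rcases List.eq_nil_or_concat C with rfl | ⟨D, x, rfl⟩
    · simp at h2
    · obtain rfl : x = ⊥ := by simpa using h3
      rcases List.eq_nil_or_concat D with rfl | ⟨E, y, rfl⟩
      · simp
      · simp only [List.concat_eq_append] at h1 h2 h3 ⊢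
        rw [List.isChain_append] at h1
        exact absurd (h1.2.2 y (by simp) ⊥ (by simp)).lt not_lt_bot
  · rintro rfl
    exact ⟨by simp, rfl, rfl⟩

theorem isSatChain_coe {C : List (WithBot P)} {a : P} :
    IsSatChain C a ↔ ∃ D b, C = D ++ [b, (a : WithBot P)] ∧ b ⋖ a ∧ IsSatChain (D ++ [b]) b := by
  constructor
  · rintro ⟨h1, h2, h3⟩
    rcases List.eq_nil_or_concat C with rfl | ⟨D, x, rfl⟩
    · simp at h2
    · obtain rfl : x = a := by simpa using h3
      rcases List.eq_nil_or_concat D with rfl | ⟨E, y, rfl⟩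
      · simp at h2
      · simp only [List.concat_eq_append] at h1 h2 h3 ⊢
        rw [List.isChain_append] at h1
        refine ⟨E, y, by simp, h1.2.2 y (by simp) _ (by simp), h1.1, ?_, by simp⟩
        cases E <;> simpa using h2
  · rintro ⟨D, b, rfl, hb, h1, h2, h3⟩
    refine ⟨?_, ?_, by simp⟩
    · rw [show D ++ [b, (a : WithBot P)] = (D ++ [b]) ++ [(a : WithBot P)] by simp,
        List.isChain_append]
      refine ⟨h1, by simp, ?_⟩
      simpa using hb
    · cases D <;> simpa using h2

end

end PosetStat

/-! ### Reduction to parent functions on labels -/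

namespace PosetStat

section

variable {P : Type*} [PartialOrder P] {n : ℕ}

/-- A parent function on labels that describes the covering relation of `P` with a minimum
adjoined. -/
def IsParent (ω : P ≃ Fin n) (par : ℕ → ℕ) : Prop :=
  (∀ i < n, par (i + 1) ≤ i) ∧
    ∀ (a : P), ∃ b : WithBot P, b ⋖ a ∧ (∀ c : WithBot P, c ⋖ a → c = b) ∧
      (label ω b : ℕ) = par (ω a + 1)

theorem IsNatural.exists_isParent {ω : P ≃ Fin n} (hω : IsNatural ω) (hP : IsRootedTree P) :
    ∃ par, IsParent ω par := by
  have : Finite P := Finite.of_equiv _ ω.symm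
  choose b hb hu using hP.existsUnique_covBy
  -- Label `k` belongs to index `k - 1`; the value `0` beyond `n` is arbitrary.
  refine ⟨fun k => if h : k - 1 < n then label ω (b (ω.symm ⟨k - 1, h⟩)) else 0, ?_, ?_⟩
  · intro i hi
    have hlt := (hb (ω.symm ⟨i, hi⟩)).lt
    simp only [Nat.add_sub_cancel, hi, dif_pos]
    generalize b (ω.symm ⟨i, hi⟩) = c at hlt ⊢
    induction c with
    | bot => simp [label]
    | coe c =>
      have := hω _ _ (WithBot.coe_lt_coe.1 hlt)
      rw [Equiv.apply_symm_apply] at this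
      simp only [label, WithBot.recBotCoe_coe, Fin.val_succ]
      exact this
  · intro a
    exact ⟨b a, hb a, hu a, by simp⟩

theorem chainDes_append_pair {P : Type*} {n : ℕ} (ω : P ≃ Fin n) (τ : Equiv.Perm (Fin n))
    (D : List (WithBot P))
    (b a : WithBot P) : chainDes ω τ (D ++ [b, a]) =
      chainDes ω τ (D ++ [b]) + (if hat τ (label ω a) < hat τ (label ω b) then 1 else 0) := by
  simp only [chainDes, List.map_append, List.map_cons, List.map_nil]
  exact wordDes_append_pair _ _ _

/-- Existence of a chain is included because `desP` is an infimum, which would be 0 on the empty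
set. -/
theorem IsParent.chainDes_eq {ω : P ≃ Fin n} {par : ℕ → ℕ} (h : IsParent ω par)
    (τ : Equiv.Perm (Fin n)) (k : ℕ) : ∀ a : WithBot P, (label ω a : ℕ) = k →
      (∃ C, IsSatChain C a) ∧ ∀ C, IsSatChain C a → chainDes ω τ C = level par (pos τ) k := by
  induction k using Nat.strong_induction_on with
  | _ k ih =>
    intro a hk
    induction a with
    | bot =>
      refine ⟨⟨_, isSatChain_bot.2 rfl⟩, fun C hC => ?_⟩
      obtain rfl : k = 0 := by rw [← hk]; rfl
      rw [isSatChain_bot.1 hC, level_zero]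
      rfl
    | coe a =>
      obtain ⟨b, hb, hu, hlab⟩ := h.2 a
      obtain rfl : (ω a : ℕ) + 1 = k := by rw [← hk]; rfl
      have hpar : par (ω a + 1) < ω a + 1 := Nat.lt_succ_of_le (h.1 _ (ω a).2)
      obtain ⟨⟨E, hE⟩, hd⟩ := ih _ hpar b hlab
      constructor
      · rcases List.eq_nil_or_concat E with rfl | ⟨D, x, rfl⟩
        · simp [IsSatChain] at hE
        · rw [List.concat_eq_append] at hE
          obtain rfl : x = b := by simpa using hE.2.2
          exact ⟨_, isSatChain_coe.2 ⟨D, x, rfl, hb, hE⟩⟩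
      · intro C hC
        obtain ⟨D, c, rfl, hc, hD⟩ := isSatChain_coe.1 hC
        obtain rfl := hu c hc
        rw [chainDes_append_pair, hd _ hD, level_of_lt hpar, ← hlab, ← hk, pos_val, pos_val]
        rfl

theorem IsParent.isDescentCompatible {ω : P ≃ Fin n} {par : ℕ → ℕ} (h : IsParent ω par)
    (τ : Equiv.Perm (Fin n)) : IsDescentCompatible ω τ := fun a C C' hC hC' => by
  rw [(h.chainDes_eq τ _ a rfl).2 C hC, (h.chainDes_eq τ _ a rfl).2 C' hC']

theorem IsParent.desP_unlabel {ω : P ≃ Fin n} {par : ℕ → ℕ} (h : IsParent ω par)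
    (τ : Equiv.Perm (Fin n)) (i : Fin (n + 1)) :
    desP ω τ (unlabel ω i) = level par (pos τ) i := by
  have hl := label_unlabel ω i
  generalize unlabel ω i = a at hl ⊢
  subst hl
  induction a with
  | bot => rw [desP_bot]; exact (level_zero _ _).symm
  | coe a =>
    obtain ⟨⟨C, hC⟩, hd⟩ := h.chainDes_eq τ _ a rfl
    rw [desP_eq (h.isDescentCompatible τ) hC, hd C hC]

theorem IsParent.stat_eq {ω : P ≃ Fin n} {par : ℕ → ℕ} (h : IsParent ω par)
    (τ : Equiv.Perm (Fin n)) : stat ω τ = permStat par τ := by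
  unfold stat permStat
  congr 1
  ext i
  simp [h.desP_unlabel, LevelLT, iDes, Des]

theorem IsParent.genFun_eq {ω : P ≃ Fin n} {par : ℕ → ℕ} (h : IsParent ω par) :
    GenFun ω = ∑ τ : Equiv.Perm (Fin n), X ^ permStat par τ := by
  classical
  unfold GenFun
  rw [Finset.filter_true_of_mem fun τ _ => h.isDescentCompatible τ]
  simp only [h.stat_eq]

end

theorem A2_eq_sum_permStat {par : ℕ → ℕ} (n : ℕ) (h : ∀ i < n, par (i + 1) ≤ i) :
    A2 n = ∑ τ : Equiv.Perm (Fin n), X ^ permStat par τ := by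
  rw [← sum_permStat_eq (par := fun k => k - 1) n (by simp) h fun s => (X : ℤ[X]) ^ s]
  simp only [permStat_pred, A2]

end PosetStat

theorem corollary3p6 {P : Type*} [PartialOrder P] (n : ℕ) (ω : P ≃ Fin n)
    (hω : PosetStat.IsNatural ω) (hP : PosetStat.IsRootedTree P) :
    PosetStat.GenFun ω = PosetStat.A2 n ∧
      PosetStat.A2 n = ∑ τ : Equiv.Perm (Fin n), (X : ℤ[X]) ^ PosetStat.ides τ := by
  obtain ⟨par, h⟩ := hω.exists_isParent hP
  refine ⟨?_, ?_⟩
  · rw [h.genFun_eq, PosetStat.A2_eq_sum_permStat n h.1]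
  · rw [PosetStat.A2_eq_sum_permStat (par := fun _ => 0) n (by simp)]
    simp only [PosetStat.permStat_const_zero]
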